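/- For a semigroup $S$ let $S^1$ denote $S$ with an identity adjoined. For $a,b\in S$ write $a\,\mathcal{R}^{*}\,b$ if for all $x,y\in S^1$ we have $xa=ya \iff xb=yb$, and write $a\,\widetilde{\mathcal{R}}\,b$ if for every idempotent $e\in S$ we have $ea=a\iff eb=b$. The semigroup $S$ is *left abundant* (respectively *left Fountain*) if every element of $S$ is $\mathcal{R}^{*}$-related (respectively $\widetilde{\mathcal{R}}$-related) to an idempotent of $S$. Let $\Gamma=(V,E)$ be a simple undirected graph without loops (possibly infinite), and let $\mathcal{S}=\{S_\alpha:\alpha\in V\}$ be a family of pairwise disjoint semigroups. The *semigroup graph product* $\mathscr{GPS}(\Gamma,\mathcal{S})$ is the quotient of the free semigroup $X^{+}$ on $X=\bigcup_{\alpha\in V}S_\alpha$, whose operation is written $\circ$, by the congruence generated by the relations $x\circ y=xy$ for $x,y\in S_\alpha$, $\alpha\in V$, and $x\circ y=y\circ x$ for $x\in S_\alpha$, $y\in S_\beta$, $\{\alpha,\beta\}\in E$. 1. If every $S_\alpha$ is left abundant, then $\mathscr{GPS}(\Gamma,\mathcal{S})$ is left abundant. 2. If every $S_\alpha$ is left Fountain,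 then $\mathscr{GPS}(\Gamma,\mathcal{S})$ is left Fountain. -/

import Mathlib

universe u v

/-- The relation `R*` on a semigroup `S`: `a R* b` iff for all `x, y ∈ S¹` we have
`x a = y a ↔ x b = y b`. Here `S¹` is `WithOne S`, i.e. `S` with a fresh identity adjoined; if `S`
already has an identity, letting `x, y` range over `S` alone gives the same relation. -/
def RStar {S : Type u} [Semigroup S] (a b : S) : Prop :=
  ∀ x y : WithOne S,
    x * (a : WithOne S) = y * (a : WithOne S) ↔ x * (b : WithOne S) = y * (b : WithOne S)

/-- The relation `R~` on a semigroup: `a` and `b` have the same idempotent left identities. -/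
def RTilde {S : Type u} [Semigroup S] (a b : S) : Prop :=
  ∀ e : S, IsIdempotentElem e → (e * a = a ↔ e * b = b)

/-- A semigroup is left abundant if every element is `R*`-related to an idempotent. -/
def IsLeftAbundant (S : Type u) [Semigroup S] : Prop :=
  ∀ a : S, ∃ e : S, IsIdempotentElem e ∧ RStar a e

/-- A semigroup is left Fountain if every element is `R~`-related to an idempotent. -/
def IsLeftFountain (S : Type u) [Semigroup S] : Prop :=
  ∀ a : S, ∃ e : S, IsIdempotentElem e ∧ RTilde a e

/-- The defining relations of the semigroup graph product, on the free semigroup over the disjoint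
union `Σ α, S α` of the vertex semigroups. -/
inductive SemigroupGraphProduct.Rel {V : Type u} (Γ : SimpleGraph V) (S : V → Type v)
    [∀ α, Semigroup (S α)] :
    FreeSemigroup (Σ α, S α) → FreeSemigroup (Σ α, S α) → Prop
  /-- multiplication inside a vertex semigroup -/
  | vertex (α : V) (x y : S α) :
      SemigroupGraphProduct.Rel Γ S
        (FreeSemigroup.of ⟨α, x⟩ * FreeSemigroup.of ⟨α, y⟩) (FreeSemigroup.of ⟨α, x * y⟩)
  /-- elements of adjacent vertex semigroups commute -/
  | edge (α β : V) (h : Γ.Adj α β) (x : S α) (y : S β) :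
      SemigroupGraphProduct.Rel Γ S
        (FreeSemigroup.of ⟨α, x⟩ * FreeSemigroup.of ⟨β, y⟩)
        (FreeSemigroup.of ⟨β, y⟩ * FreeSemigroup.of ⟨α, x⟩)

/-- The semigroup graph product: the quotient of the free semigroup on `Σ α, S α` by the
congruence generated by the vertex and edge relations. -/
def SemigroupGraphProduct {V : Type u} (Γ : SimpleGraph V) (S : V → Type v)
    [∀ α, Semigroup (S α)] : Type (max u v) :=
  (conGen (SemigroupGraphProduct.Rel Γ S)).Quotient

instance SemigroupGraphProduct.instSemigroup {V : Type u} (Γ : SimpleGraph V) (S : V → Type v)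
    [∀ α, Semigroup (S α)] : Semigroup (SemigroupGraphProduct Γ S) :=
  inferInstanceAs (Semigroup (conGen (SemigroupGraphProduct.Rel Γ S)).Quotient)

/-! Call two elements of a monoid equivalent when right multiplication by them has the same kernel
(`SameRightMulKer`); on `S¹` this is `R*`, and it is preserved by left multiplication.

Every element of the graph product is equivalent to a product of letters over a nonempty clique of
`Γ` (`exists_isCliqueList`). To see this, multiply a clique product on the left by a letter `p`. If
the vertex of `p` occurs in the clique, the two letters merge. Otherwise the letters adjacent to `p`
move in front of it, and the others, blocked by `p`, can be cancelled on the right and are dropped.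

Such cancellations are checked on a faithful right action on traces, that is, on words up to
commutation. Traces need not be reduced, so no normal form theorem is required.

Replacing each letter of a clique product by a related idempotent of its vertex semigroup gives an
idempotent, since the letters commute. For `R*` the equivalence survives letter by letter. For `R~`
the left identities of a clique product are read off coordinatewise from the projections to the
vertex semigroups (`mul_listProd_eq_self_iff`). -/

namespace SemigroupGraphProduct

/-- Two elements of a monoid induce the same kernel by right multiplication. -/
def SameRightMulKer {M : Type*} [Monoid M] (a b : M) : Prop :=
  ∀ x y : M, x * a = y * a ↔ x * b = y * b

namespace SameRightMulKer

variable {M : Type*} [Monoid M] {a b c : M}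

theorem refl (a : M) : SameRightMulKer a a := fun _ _ => Iff.rfl

theorem trans (h : SameRightMulKer a b) (h' : SameRightMulKer b c) : SameRightMulKer a c :=
  fun x y => (h x y).trans (h' x y)

theorem mul_left (h : SameRightMulKer a b) (c : M) : SameRightMulKer (c * a) (c * b) := by
  intro x y
  simpa only [mul_assoc] using h (x * c) (y * c)

end SameRightMulKer

/-! ### Letters, induction and the universal property -/

section Hom

variable {V : Type u} {Γ : SimpleGraph V} {S : V → Type v} [∀ α, Semigroup (S α)]

/-- A letter as an element of the graph product. -/
def letter (Γ : SimpleGraph V) (p : Σ α, S α) : SemigroupGraphProduct Γ S :=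
  ((FreeSemigroup.of p : FreeSemigroup (Σ α, S α)) : (conGen (Rel Γ S)).Quotient)

theorem letter_mul_letter (α : V) (x y : S α) :
    letter Γ ⟨α, x⟩ * letter Γ ⟨α, y⟩ = letter Γ ⟨α, x * y⟩ :=
  (Con.eq _).2 (ConGen.Rel.of _ _ (Rel.vertex α x y))

theorem commute_letter {p q : Σ α, S α} (h : Γ.Adj p.1 q.1) :
    Commute (letter Γ p) (letter Γ q) :=
  (Con.eq _).2 (ConGen.Rel.of _ _ (Rel.edge p.1 q.1 h p.2 q.2))

theorem induction_on {C : SemigroupGraphProduct Γ S → Prop} (a : SemigroupGraphProduct Γ S)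
    (h_letter : ∀ p, C (letter Γ p)) (h_mul : ∀ p b, C b → C (letter Γ p * b)) : C a := by
  obtain ⟨w, rfl⟩ := Quot.exists_rep a
  induction w using FreeSemigroup.recOnMul with
  | ih1 p => exact h_letter p
  | ih2 p w _ h => exact h_mul p _ h

/-- The universal property of the graph product. -/
def lift {T : Type*} [Semigroup T] (f : (Σ α, S α) → T)
    (hv : ∀ α (x y : S α), f ⟨α, x⟩ * f ⟨α, y⟩ = f ⟨α, x * y⟩)
    (he : ∀ p q : Σ α, S α, Γ.Adj p.1 q.1 → f p * f q = f q * f p) :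
    SemigroupGraphProduct Γ S →ₙ* T where
  toFun a := Con.liftOn (c := conGen (Rel Γ S)) a (FreeSemigroup.lift f) (by
    have : conGen (Rel Γ S) ≤ Con.ker (FreeSemigroup.lift f) := by
      rw [Con.conGen_le]
      rintro _ _ (⟨α, x, y⟩ | ⟨α, β, h, x, y⟩)
      · simpa [Con.ker_rel] using hv α x y
      · simpa [Con.ker_rel] using he ⟨α, x⟩ ⟨β, y⟩ h
    exact fun a b h => this h)
  map_mul' a b := by
    obtain ⟨a, rfl⟩ := Quot.exists_rep a
    obtain ⟨b, rfl⟩ := Quot.exists_rep b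
    exact map_mul (FreeSemigroup.lift f) a b

/-- A letter as an element of the graph product with an identity adjoined. -/
def letterOne (Γ : SimpleGraph V) (p : Σ α, S α) : WithOne (SemigroupGraphProduct Γ S) :=
  (letter Γ p : SemigroupGraphProduct Γ S)

theorem letterOne_mul (α : V) (x y : S α) :
    letterOne Γ ⟨α, x⟩ * letterOne Γ ⟨α, y⟩ = letterOne Γ ⟨α, x * y⟩ := by
  simp only [letterOne, ← WithOne.coe_mul, letter_mul_letter]

theorem commute_letterOne {p q : Σ α, S α} (h : Γ.Adj p.1 q.1) :
    Commute (letterOne Γ p) (letterOne Γ q) := by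
  have := commute_letter (Γ := Γ) h
  simp only [Commute, SemiconjBy, letterOne, ← WithOne.coe_mul] at this ⊢
  rw [this]

theorem induction_on_withOne {C : WithOne (SemigroupGraphProduct Γ S) → Prop}
    (a : WithOne (SemigroupGraphProduct Γ S))
    (h_one : C 1) (h_mul : ∀ p b, C b → C (letterOne Γ p * b)) : C a := by
  induction a using WithOne.recOneCoe with
  | one => exact h_one
  | coe a =>
    induction a using induction_on with
    | h_letter p => simpa [letterOne] using h_mul p 1 h_one
    | h_mul p b ih => simpa [letterOne] using h_mul p b ih

end Hom

/-! ### Traces and their top letters -/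

section Trace

variable {V : Type u} (Γ : SimpleGraph V) (S : V → Type v)

/-- The swap of two consecutive letters with adjacent vertices. -/
inductive Swap : List (Σ α, S α) → List (Σ α, S α) → Prop
  | swap (p q : Σ α, S α) (l : List (Σ α, S α)) (h : Γ.Adj p.1 q.1) :
      Swap (p :: q :: l) (q :: p :: l)
  | cons (p : Σ α, S α) {l l' : List (Σ α, S α)} (h : Swap l l') : Swap (p :: l) (p :: l')

/-- Words up to swaps, read from the last letter to the first. -/
def Trace : Type (max u v) := Quot (Swap Γ S)

variable {Γ S}

namespace Trace

/-- The empty trace. -/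
def nil : Trace Γ S := Quot.mk _ []

/-- Add a letter on top of a trace. -/
def cons (p : Σ α, S α) : Trace Γ S → Trace Γ S :=
  Quot.map (List.cons p) fun _ _ h => Swap.cons p h

theorem cons_comm {p q : Σ α, S α} (h : Γ.Adj p.1 q.1) (n : Trace Γ S) :
    cons p (cons q n) = cons q (cons p n) := by
  obtain ⟨l, rfl⟩ := Quot.exists_rep n
  exact Quot.sound (Swap.swap p q l h)

theorem ind {C : Trace Γ S → Prop} (n : Trace Γ S) (h_nil : C nil)
    (h_cons : ∀ p m, C m → C (cons p m)) : C n := by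
  obtain ⟨l, rfl⟩ := Quot.exists_rep n
  induction l with
  | nil => exact h_nil
  | cons p l ih => exact h_cons p _ ih

open scoped Classical in
/-- Remove from a word the letter of vertex `α` that can be moved to the top, if there is one. -/
noncomputable def extractList (α : V) : List (Σ α, S α) → Option (S α × Trace Γ S)
  | [] => none
  | p :: l =>
    if h : p.1 = α then some (h ▸ p.2, Quot.mk _ l)
    else if Γ.Adj p.1 α then (extractList α l).map (Prod.map id (cons p))
    else none

/-- If one of the swapped letters lies at `α`, the other is adjacent to `α` and does not block it.
Otherwise both have to be passed, in either order, and the remainders agree by `cons_comm`. -/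
theorem extractList_swap (α : V) {l l' : List (Σ α, S α)} (h : Swap Γ S l l') :
    extractList (Γ := Γ) α l = extractList α l' := by
  induction h with
  | swap p q l h =>
    obtain ⟨β, x⟩ := p
    obtain ⟨γ, y⟩ := q
    dsimp only at h
    by_cases hβ : β = α
    · subst hβ
      have hγ : γ ≠ β := h.ne'
      simp only [extractList, dif_pos, dif_neg hγ, if_pos h.symm]
      rfl
    · by_cases hγ : γ = α
      · subst hγ
        simp only [extractList, dif_pos, dif_neg hβ, if_pos h]
        rfl
      · simp only [extractList, dif_neg hβ, dif_neg hγ]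
        by_cases h1 : Γ.Adj β α <;> by_cases h2 : Γ.Adj γ α <;>
          simp only [h1, h2, if_true, if_false, Option.map_map, Option.map_none]
        congr 1
        funext z
        simp [Prod.map, cons_comm (p := ⟨β, x⟩) (q := ⟨γ, y⟩) h]
  | cons p h ih =>
    simp only [extractList, ih, Quot.sound h]

/-- Remove from a trace the letter of vertex `α` that can be moved to the top, if there is one. -/
noncomputable def extract (α : V) : Trace Γ S → Option (S α × Trace Γ S) :=
  Quot.lift (extractList α) fun _ _ h => extractList_swap α h

theorem extract_cons_self (α : V) (x : S α) (n : Trace Γ S) :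
    extract α (cons ⟨α, x⟩ n) = some (x, n) := by
  obtain ⟨l, rfl⟩ := Quot.exists_rep n
  simp [extract, cons, Quot.map, extractList]

theorem extract_cons_adj {α : V} {p : Σ α, S α} (h : Γ.Adj p.1 α) (n : Trace Γ S) :
    extract α (cons p n) = (extract α n).map (Prod.map id (cons p)) := by
  obtain ⟨l, rfl⟩ := Quot.exists_rep n
  simp [extract, cons, Quot.map, extractList, h.ne, h]

theorem extract_cons_not_adj {α : V} {p : Σ α, S α} (h : ¬ Γ.Adj p.1 α) (h' : p.1 ≠ α)
    (n : Trace Γ S) : extract α (cons p n) = none := by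
  obtain ⟨l, rfl⟩ := Quot.exists_rep n
  simp [extract, cons, Quot.map, extractList, h, h']

theorem eq_cons_of_extract {α : V} {x : S α} (n : Trace Γ S) {m : Trace Γ S}
    (h : extract α n = some (x, m)) : n = cons ⟨α, x⟩ m := by
  induction n using ind generalizing m with
  | h_nil => simp [extract, nil, extractList] at h
  | h_cons p n ih =>
    obtain ⟨β, y⟩ := p
    by_cases hβ : β = α
    · subst hβ
      simp only [extract_cons_self, Option.some.injEq, Prod.mk.injEq] at h
      rw [h.1, h.2]
    · by_cases ha : Γ.Adj β α
      · rw [extract_cons_adj (p := ⟨β, y⟩) ha] at h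
        obtain ⟨⟨z, k⟩, hk, he⟩ := Option.map_eq_some_iff.1 h
        simp only [Prod.map, id, Prod.mk.injEq] at he
        obtain ⟨rfl, rfl⟩ := he
        rw [ih hk, cons_comm (p := ⟨β, y⟩) (q := ⟨α, z⟩) ha]
      · simp [extract_cons_not_adj (p := ⟨β, y⟩) ha hβ] at h

theorem cons_injective (p : Σ α, S α) : Function.Injective (cons (Γ := Γ) p) := by
  intro n m h
  obtain ⟨α, x⟩ := p
  have := congrArg (extract α) h
  simpa [extract_cons_self] using this

theorem exists_eq_cons {α : V} {n : Trace Γ S} (h : extract α n ≠ none) :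
    ∃ x m, n = cons ⟨α, x⟩ m := by
  obtain ⟨⟨x, m⟩, h⟩ := Option.ne_none_iff_exists'.1 h
  exact ⟨x, m, eq_cons_of_extract n h⟩

theorem extract_cons_adj_eq_none {α : V} {p : Σ α, S α} (h : Γ.Adj p.1 α) {n : Trace Γ S} :
    extract α (cons p n) = none ↔ extract α n = none := by
  simp [extract_cons_adj h]

/-! ### The faithful right action of the graph product on traces -/

variable [∀ α, Semigroup (S α)]

/-- Multiply a trace by a letter, merging it with the top letter of the same vertex. -/
noncomputable def act (p : Σ α, S α) (n : Trace Γ S) : Trace Γ S :=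
  match extract p.1 n with
  | none => cons p n
  | some (y, m) => cons ⟨p.1, y * p.2⟩ m

theorem act_of_extract_none {p : Σ α, S α} {n : Trace Γ S} (h : extract p.1 n = none) :
    act p n = cons p n := by
  simp [act, h]

theorem act_cons_self (α : V) (x y : S α) (n : Trace Γ S) :
    act ⟨α, y⟩ (cons ⟨α, x⟩ n) = cons ⟨α, x * y⟩ n := by
  simp [act, extract_cons_self]

theorem act_act (α : V) (x y : S α) (n : Trace Γ S) :
    act ⟨α, y⟩ (act ⟨α, x⟩ n) = act ⟨α, x * y⟩ n := by
  by_cases h : extract α n = none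
  · rw [act_of_extract_none (p := ⟨α, x⟩) h, act_of_extract_none (p := ⟨α, x * y⟩) h,
      act_cons_self]
  · obtain ⟨z, m, rfl⟩ := exists_eq_cons h
    simp only [act_cons_self, mul_assoc]

theorem act_cons_adj {p q : Σ α, S α} (h : Γ.Adj p.1 q.1) (n : Trace Γ S) :
    act p (cons q n) = cons q (act p n) := by
  by_cases hn : extract p.1 n = none
  · rw [act_of_extract_none hn, act_of_extract_none ((extract_cons_adj_eq_none h.symm).2 hn),
      cons_comm h]
  · obtain ⟨z, m, rfl⟩ := exists_eq_cons hn
    obtain ⟨α, x⟩ := p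
    dsimp only at h z
    rw [← cons_comm (p := ⟨α, z⟩) h, act_cons_self, act_cons_self,
      cons_comm (p := ⟨α, z * x⟩) h]

theorem extract_act_adj_eq_none {α : V} {p : Σ α, S α} (h : Γ.Adj p.1 α) {n : Trace Γ S} :
    extract α (act p n) = none ↔ extract α n = none := by
  by_cases hn : extract p.1 n = none
  · rw [act_of_extract_none hn, extract_cons_adj_eq_none h]
  · obtain ⟨z, m, rfl⟩ := exists_eq_cons hn
    obtain ⟨β, x⟩ := p
    dsimp only at h z
    rw [act_cons_self, extract_cons_adj_eq_none (p := ⟨β, z * x⟩) h,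
      extract_cons_adj_eq_none (p := ⟨β, z⟩) h]

theorem act_comm {p q : Σ α, S α} (h : Γ.Adj p.1 q.1) (n : Trace Γ S) :
    act p (act q n) = act q (act p n) := by
  by_cases hn : extract q.1 n = none
  · rw [act_of_extract_none hn, act_cons_adj h,
      act_of_extract_none ((extract_act_adj_eq_none h).2 hn)]
  · obtain ⟨z, m, rfl⟩ := exists_eq_cons hn
    obtain ⟨β, x⟩ := q
    dsimp only at h z
    rw [act_cons_self, act_cons_adj (q := ⟨β, z * x⟩) h, act_cons_adj (q := ⟨β, z⟩) h,
      act_cons_self]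

/-- The right action of the graph product on traces. -/
noncomputable def actHom (Γ : SimpleGraph V) (S : V → Type v) [∀ α, Semigroup (S α)] :
    WithOne (SemigroupGraphProduct Γ S) →* (Function.End (Trace Γ S))ᵐᵒᵖ :=
  WithOne.lift (lift (fun p => MulOpposite.op (act p : Function.End (Trace Γ S)))
    (fun α x y => congrArg MulOpposite.op (funext fun n => act_act α x y n))
    (fun _ _ h => congrArg MulOpposite.op (funext fun n => (act_comm h n).symm)))

/-- The result of acting with an element of the graph product on a trace. -/
noncomputable def smul (a : WithOne (SemigroupGraphProduct Γ S)) (n : Trace Γ S) : Trace Γ S :=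
  (actHom Γ S a).unop n

theorem smul_one (n : Trace Γ S) : smul 1 n = n := by
  simp only [smul, map_one]
  rfl

theorem smul_mul (a b : WithOne (SemigroupGraphProduct Γ S)) (n : Trace Γ S) :
    smul (a * b) n = smul b (smul a n) := by
  simp only [smul, map_mul]
  rfl

theorem smul_letterOne (p : Σ α, S α) (n : Trace Γ S) :
    smul (letterOne Γ p) n = act p n :=
  rfl

/-- The product of the letters of a trace. -/
noncomputable def eval : Trace Γ S → WithOne (SemigroupGraphProduct Γ S) :=
  Quot.lift (fun l => ((l.map (letterOne Γ)).reverse).prod) (by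
    intro l l' h
    induction h with
    | swap p q l h =>
      simp only [List.map_cons, List.reverse_cons, List.prod_append, List.prod_singleton,
        mul_assoc, (commute_letterOne h).eq]
    | cons p h ih =>
      simp only [List.map_cons, List.reverse_cons, List.prod_append, ih])

theorem eval_nil : eval (nil : Trace Γ S) = 1 := by
  simp [eval, nil]

theorem eval_cons (p : Σ α, S α) (n : Trace Γ S) :
    eval (cons p n) = eval n * letterOne Γ p := by
  obtain ⟨l, rfl⟩ := Quot.exists_rep n
  simp [eval, cons, Quot.map]

theorem eval_act (p : Σ α, S α) (n : Trace Γ S) :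
    eval (act p n) = eval n * letterOne Γ p := by
  by_cases hn : extract p.1 n = none
  · rw [act_of_extract_none hn, eval_cons]
  · obtain ⟨z, m, rfl⟩ := exists_eq_cons hn
    obtain ⟨α, x⟩ := p
    simp only [act_cons_self, eval_cons, mul_assoc, letterOne_mul]

theorem eval_smul (a : WithOne (SemigroupGraphProduct Γ S)) (n : Trace Γ S) :
    eval (smul a n) = eval n * a := by
  induction a using induction_on_withOne generalizing n with
  | h_one => simp [smul_one]
  | h_mul p b ih => rw [smul_mul, ih, smul_letterOne, eval_act, mul_assoc]

/-- `eval` recovers an element from its action on the empty trace, so equations in the graph product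
can be tested on traces. -/
theorem smul_nil_injective :
    Function.Injective fun a : WithOne (SemigroupGraphProduct Γ S) => smul a nil := by
  intro a b h
  simpa [eval_smul, eval_nil] using congrArg eval h

theorem mul_right_eq_iff (x y a : WithOne (SemigroupGraphProduct Γ S)) :
    x * a = y * a ↔ smul a (smul x nil) = smul a (smul y nil) := by
  rw [← smul_mul, ← smul_mul]
  exact smul_nil_injective.eq_iff.symm

/-- The top letter at `α` behaves like an element of `S α` with identity adjoined, a missing letter
counting as `1`. Comparing top letters turns the hypothesis into an equation to which `R*` applies.
-/
theorem act_eq_of_rStar {α : V} {s t : S α} (h : RStar s t) {n m : Trace Γ S}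
    (hnm : act ⟨α, s⟩ n = act ⟨α, s⟩ m) : act ⟨α, t⟩ n = act ⟨α, t⟩ m := by
  by_cases hn : extract α n = none <;> by_cases hm : extract α m = none
  · rw [act_of_extract_none (p := ⟨α, s⟩) hn, act_of_extract_none (p := ⟨α, s⟩) hm] at hnm
    rw [cons_injective _ hnm]
  · obtain ⟨y, k, rfl⟩ := exists_eq_cons hm
    rw [act_of_extract_none (p := ⟨α, s⟩) hn, act_cons_self] at hnm
    have := congrArg (extract α) hnm
    simp only [extract_cons_self, Option.some.injEq, Prod.mk.injEq] at this
    -- Here `s = y * s`; the side without a top letter contributes the adjoined identity.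
    have ht := (h 1 y).1 (by rw [one_mul, ← WithOne.coe_mul, ← this.1])
    rw [one_mul, ← WithOne.coe_mul, WithOne.coe_inj] at ht
    rw [act_of_extract_none (p := ⟨α, t⟩) hn, act_cons_self, ← ht, this.2]
  · obtain ⟨y, k, rfl⟩ := exists_eq_cons hn
    rw [act_of_extract_none (p := ⟨α, s⟩) hm, act_cons_self] at hnm
    have := congrArg (extract α) hnm
    simp only [extract_cons_self, Option.some.injEq, Prod.mk.injEq] at this
    have ht := (h y 1).1 (by rw [one_mul, ← WithOne.coe_mul, this.1])
    rw [one_mul, ← WithOne.coe_mul, WithOne.coe_inj] at ht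
    rw [act_of_extract_none (p := ⟨α, t⟩) hm, act_cons_self, ht, this.2]
  · obtain ⟨y, k, rfl⟩ := exists_eq_cons hn
    obtain ⟨z, k', rfl⟩ := exists_eq_cons hm
    rw [act_cons_self, act_cons_self] at hnm
    have := congrArg (extract α) hnm
    simp only [extract_cons_self, Option.some.injEq, Prod.mk.injEq] at this
    have ht := (h y z).1 (by rw [← WithOne.coe_mul, this.1, WithOne.coe_mul])
    rw [← WithOne.coe_mul, ← WithOne.coe_mul, WithOne.coe_inj] at ht
    rw [act_cons_self, act_cons_self, ht, this.2]

end Trace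

end Trace

/-! ### Reduction to products over cliques -/

section Clique

variable {V : Type u} {Γ : SimpleGraph V} {S : V → Type v}

/-- The vertices of the letters of a list are distinct and pairwise adjacent. -/
def IsCliqueList (Γ : SimpleGraph V) (l : List (Σ α, S α)) : Prop :=
  l.Pairwise fun p q => Γ.Adj p.1 q.1

theorem IsCliqueList.perm {l l' : List (Σ α, S α)} (h : IsCliqueList Γ l) (hp : l.Perm l') :
    IsCliqueList Γ l' :=
  (hp.pairwise_iff fun h => h.symm).1 h

variable [∀ α, Semigroup (S α)]

/-- The product of a list of letters. -/
def listProd (Γ : SimpleGraph V) (l : List (Σ α, S α)) : WithOne (SemigroupGraphProduct Γ S) :=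
  (l.map (letterOne Γ)).prod

theorem listProd_nil : listProd Γ ([] : List (Σ α, S α)) = 1 := rfl

theorem listProd_cons (p : Σ α, S α) (l : List (Σ α, S α)) :
    listProd Γ (p :: l) = letterOne Γ p * listProd Γ l := by
  simp [listProd]

theorem listProd_append (l l' : List (Σ α, S α)) :
    listProd Γ (l ++ l') = listProd Γ l * listProd Γ l' := by
  simp [listProd]

theorem listProd_perm {l l' : List (Σ α, S α)} (h : IsCliqueList Γ l) (hp : l.Perm l') :
    listProd Γ l = listProd Γ l' :=
  (hp.map _).prod_eq' (List.pairwise_map.2 (h.imp fun h => commute_letterOne h))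

theorem commute_listProd {p : Σ α, S α} {l : List (Σ α, S α)} (h : ∀ q ∈ l, Γ.Adj p.1 q.1) :
    Commute (letterOne Γ p) (listProd Γ l) := by
  refine Commute.list_prod_right _ _ fun x hx => ?_
  obtain ⟨q, hq, rfl⟩ := List.mem_map.1 hx
  exact commute_letterOne (h q hq)

theorem exists_coe_eq_listProd {l : List (Σ α, S α)} (hl : l ≠ []) :
    ∃ a : SemigroupGraphProduct Γ S, (a : WithOne (SemigroupGraphProduct Γ S)) = listProd Γ l := by
  obtain ⟨p, l, rfl⟩ := List.exists_cons_of_ne_nil hl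
  rw [listProd_cons]
  induction listProd Γ l using WithOne.recOneCoe with
  | one => exact ⟨letter Γ p, (mul_one _).symm⟩
  | coe b => exact ⟨letter Γ p * b, rfl⟩

theorem sameRightMulKer_letterOne {α : V} {s t : S α} (h : RStar s t) :
    SameRightMulKer (letterOne Γ ⟨α, s⟩) (letterOne Γ ⟨α, t⟩) := by
  intro x y
  rw [Trace.mul_right_eq_iff, Trace.mul_right_eq_iff]
  exact ⟨Trace.act_eq_of_rStar h, Trace.act_eq_of_rStar fun x y => (h x y).symm⟩

/-- A clique of letters that cannot reach the top letters of two traces acts injectively. -/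
theorem Trace.eq_of_smul_listProd_eq {l : List (Σ α, S α)} (hl : IsCliqueList Γ l)
    {n m : Trace Γ S} (hn : ∀ p ∈ l, extract p.1 n = none) (hm : ∀ p ∈ l, extract p.1 m = none)
    (h : smul (listProd Γ l) n = smul (listProd Γ l) m) : n = m := by
  induction l generalizing n m with
  | nil => simpa [listProd_nil, smul_one] using h
  | cons p l ih =>
    obtain ⟨hp, hl⟩ := List.pairwise_cons.1 hl
    have hn' := List.forall_mem_cons.1 hn
    have hm' := List.forall_mem_cons.1 hm
    rw [listProd_cons, smul_mul, smul_mul, smul_letterOne, smul_letterOne,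
      act_of_extract_none hn'.1, act_of_extract_none hm'.1] at h
    exact cons_injective p (ih hl
      (fun q hq => (extract_cons_adj_eq_none (hp q hq)).2 (hn'.2 q hq))
      (fun q hq => (extract_cons_adj_eq_none (hp q hq)).2 (hm'.2 q hq)) h)

theorem Trace.extract_act_not_adj {β : V} {p : Σ α, S α} (h : ¬ Γ.Adj p.1 β) (h' : p.1 ≠ β)
    (n : Trace Γ S) : extract β (act p n) = none := by
  by_cases hn : extract p.1 n = none
  · rw [act_of_extract_none hn, extract_cons_not_adj h h']
  · obtain ⟨z, m, rfl⟩ := exists_eq_cons hn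
    obtain ⟨α, x⟩ := p
    rw [act_cons_self]
    exact extract_cons_not_adj (p := ⟨α, z * x⟩) h h' m

/-- After `p` has acted, its letter is on top and shields everything below from the letters of `l`.
These are merely stacked, without merging, and can be cancelled. -/
theorem sameRightMulKer_letterOne_mul_listProd {p : Σ α, S α} {l : List (Σ α, S α)}
    (hl : IsCliqueList Γ l) (h : ∀ q ∈ l, ¬ Γ.Adj p.1 q.1) (h' : ∀ q ∈ l, p.1 ≠ q.1) :
    SameRightMulKer (letterOne Γ p * listProd Γ l) (letterOne Γ p) := by
  intro x y
  refine ⟨fun hxy => ?_, fun hxy => by rw [← mul_assoc, hxy, mul_assoc]⟩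
  rw [Trace.mul_right_eq_iff, Trace.smul_mul, Trace.smul_mul] at hxy
  rw [Trace.mul_right_eq_iff]
  exact Trace.eq_of_smul_listProd_eq hl
    (fun q hq => Trace.extract_act_not_adj (h q hq) (h' q hq) _)
    (fun q hq => Trace.extract_act_not_adj (h q hq) (h' q hq) _) hxy

theorem exists_isCliqueList_letterOne_mul (p : Σ α, S α) {l : List (Σ α, S α)}
    (hl : IsCliqueList Γ l) : ∃ l', l' ≠ [] ∧ IsCliqueList Γ l' ∧
      SameRightMulKer (letterOne Γ p * listProd Γ l) (listProd Γ l') := by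
  classical
  obtain ⟨α, x⟩ := p
  by_cases hα : ∃ q ∈ l, q.1 = α
  · obtain ⟨⟨_, y⟩, hq, rfl⟩ := hα
    have hp := List.perm_cons_erase hq
    have hl' := hl.perm hp
    refine ⟨⟨_, x * y⟩ :: l.erase ⟨_, y⟩, List.cons_ne_nil _ _, ?_, ?_⟩
    · exact List.pairwise_cons.2 (List.pairwise_cons.1 hl')
    · rw [listProd_perm hl hp, listProd_cons, listProd_cons, ← mul_assoc, letterOne_mul]
      exact .refl _
  · push Not at hα
    set f := l.filter fun q => Γ.Adj α q.1 with hf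
    set g := l.filter fun q => ¬ Γ.Adj α q.1 with hg
    have hp : l.Perm (f ++ g) := by
      simpa [hf, hg] using
        (List.filter_append_perm (fun q : Σ α, S α => decide (Γ.Adj α q.1)) l).symm
    have hfa : ∀ q ∈ f, Γ.Adj α q.1 := fun q hq => by simpa using (List.mem_filter.1 hq).2
    have hga : ∀ q ∈ g, ¬ Γ.Adj α q.1 := fun q hq => by simpa using (List.mem_filter.1 hq).2
    have hne : ∀ q ∈ g, α ≠ q.1 := fun q hq => (hα q (List.mem_filter.1 hq).1).symm
    have hcl : IsCliqueList Γ f := hl.sublist List.filter_sublist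
    refine ⟨⟨α, x⟩ :: f, List.cons_ne_nil _ _, List.pairwise_cons.2 ⟨hfa, hcl⟩, ?_⟩
    have hcomm := commute_listProd (p := ⟨α, x⟩) hfa
    -- Moving `f` to the left of the letter leaves the letter next to `g`, which it absorbs.
    rw [listProd_perm hl hp, listProd_append, listProd_cons, ← mul_assoc, hcomm.eq, mul_assoc]
    exact (sameRightMulKer_letterOne_mul_listProd (hl.sublist List.filter_sublist)
      hga hne).mul_left _

/-- Every element induces the same kernel as a product of letters over a clique. -/
theorem exists_isCliqueList (a : SemigroupGraphProduct Γ S) :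
    ∃ l : List (Σ α, S α), l ≠ [] ∧ IsCliqueList Γ l ∧
      SameRightMulKer (a : WithOne (SemigroupGraphProduct Γ S)) (listProd Γ l) := by
  induction a using induction_on with
  | h_letter p =>
    refine ⟨[p], List.cons_ne_nil _ _, List.pairwise_singleton _ _, ?_⟩
    rw [listProd_cons, listProd_nil, mul_one]
    exact .refl _
  | h_mul p b ih =>
    obtain ⟨l, -, hl, hb⟩ := ih
    obtain ⟨l', hne, hl', h⟩ := exists_isCliqueList_letterOne_mul p hl
    exact ⟨l', hne, hl', (hb.mul_left (letterOne Γ p)).trans h⟩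

end Clique

/-! ### Replacing the letters of a clique by idempotents -/

section Replace

variable {V : Type u} {Γ : SimpleGraph V} {S : V → Type v}

/-- Apply a map in each vertex semigroup to the letters of a list. -/
def mapLetters (f : ∀ α, S α → S α) (l : List (Σ α, S α)) : List (Σ α, S α) :=
  l.map fun p => ⟨p.1, f p.1 p.2⟩

theorem IsCliqueList.mapLetters (f : ∀ α, S α → S α) {l : List (Σ α, S α)}
    (hl : IsCliqueList Γ l) : IsCliqueList Γ (mapLetters f l) :=
  List.pairwise_map.2 hl

variable [∀ α, Semigroup (S α)]

theorem isIdempotentElem_listProd_mapLetters {f : ∀ α, S α → S α}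
    (hf : ∀ α x, IsIdempotentElem (f α x)) {l : List (Σ α, S α)} (hl : IsCliqueList Γ l) :
    IsIdempotentElem (listProd Γ (mapLetters f l)) := by
  induction l with
  | nil => exact mul_one _
  | cons p l ih =>
    obtain ⟨hp, hl⟩ := List.pairwise_cons.1 hl
    have hcomm := commute_listProd (Γ := Γ) (p := ⟨p.1, f p.1 p.2⟩) (l := mapLetters f l) (by
      intro q hq
      obtain ⟨r, hr, rfl⟩ := List.mem_map.1 hq
      exact hp r hr)
    have hidem : IsIdempotentElem (letterOne Γ ⟨p.1, f p.1 p.2⟩) := by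
      rw [IsIdempotentElem, letterOne_mul, (hf p.1 p.2).eq]
    exact (listProd_cons (Γ := Γ) ⟨p.1, f p.1 p.2⟩ (mapLetters f l)) ▸
      IsIdempotentElem.mul_of_commute hcomm hidem (ih hl)

theorem sameRightMulKer_listProd_mapLetters {f : ∀ α, S α → S α}
    (hf : ∀ α x, RStar x (f α x)) {l : List (Σ α, S α)} (hl : IsCliqueList Γ l) :
    SameRightMulKer (listProd Γ l) (listProd Γ (mapLetters f l)) := by
  induction l with
  | nil => exact .refl _
  | cons p l ih =>
    obtain ⟨hp, hl⟩ := List.pairwise_cons.1 hl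
    have hadj : ∀ q ∈ mapLetters f l, Γ.Adj p.1 q.1 := by
      intro q hq
      obtain ⟨r, hr, rfl⟩ := List.mem_map.1 hq
      exact hp r hr
    have h1 := (ih hl).mul_left (letterOne Γ p)
    have h2 := (sameRightMulKer_letterOne (Γ := Γ) (hf p.1 p.2)).mul_left
      (listProd Γ (mapLetters f l))
    -- Only left multiplication preserves the equivalence, so the letter is replaced at the right
    -- end and then commuted back to the front.
    rw [← (commute_listProd (p := ⟨p.1, p.2⟩) hadj).eq,
      ← (commute_listProd (p := ⟨p.1, f p.1 p.2⟩) hadj).eq] at h2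
    exact listProd_cons (Γ := Γ) p l ▸
      listProd_cons (Γ := Γ) ⟨p.1, f p.1 p.2⟩ (mapLetters f l) ▸ h1.trans h2

end Replace

/-! ### Projections to the vertex semigroups and left identities -/

section Projection

variable {V : Type u} {Γ : SimpleGraph V} {S : V → Type v}

open scoped Classical in
/-- The projection of a letter to a vertex semigroup with an identity adjoined. -/
noncomputable def projLetter (α : V) (p : Σ α, S α) : WithOne (S α) :=
  if h : p.1 = α then ((h ▸ p.2 : S α) : WithOne (S α)) else 1

theorem projLetter_self (α : V) (x : S α) : projLetter α ⟨α, x⟩ = (x : WithOne (S α)) := by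
  simp [projLetter]

theorem projLetter_of_ne {α : V} {p : Σ α, S α} (h : p.1 ≠ α) : projLetter α p = 1 := by
  simp [projLetter, h]

variable [∀ α, Semigroup (S α)]

/-- The projection to a vertex semigroup with an identity adjoined. -/
noncomputable def proj (Γ : SimpleGraph V) (S : V → Type v) [∀ α, Semigroup (S α)] (α : V) :
    WithOne (SemigroupGraphProduct Γ S) →* WithOne (S α) :=
  WithOne.lift (lift (projLetter α)
    (by
      intro β x y
      by_cases h : β = α
      · subst h
        simp only [projLetter_self, WithOne.coe_mul]
      · simp only [projLetter_of_ne (p := ⟨β, _⟩) h, mul_one])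
    (by
      intro p q h
      by_cases hp : p.1 = α
      · rw [projLetter_of_ne (p := q) (hp ▸ h.ne'), mul_one, one_mul]
      · rw [projLetter_of_ne hp, mul_one, one_mul]))

theorem proj_letterOne (α : V) (p : Σ α, S α) : proj Γ S α (letterOne Γ p) = projLetter α p :=
  rfl

/-- The inclusion of a vertex semigroup with an identity adjoined. -/
def incl (Γ : SimpleGraph V) (S : V → Type v) [∀ α, Semigroup (S α)] (α : V) :
    WithOne (S α) →* WithOne (SemigroupGraphProduct Γ S) :=
  WithOne.lift
    { toFun := fun x => letterOne Γ ⟨α, x⟩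
      map_mul' := fun x y => (letterOne_mul α x y).symm }

theorem commute_incl {α β : V} (h : Γ.Adj α β) (x : WithOne (S α)) (y : WithOne (S β)) :
    Commute (incl Γ S α x) (incl Γ S β y) := by
  induction x using WithOne.recOneCoe with
  | one => rw [map_one]; exact Commute.one_left _
  | coe x =>
    induction y using WithOne.recOneCoe with
    | one => rw [map_one]; exact Commute.one_right _
    | coe y => exact commute_letterOne (p := ⟨α, x⟩) (q := ⟨β, y⟩) h

/-- The product over a list of vertices of elements of the vertex semigroups. -/
def vertexProd (Γ : SimpleGraph V) (k : List V) (d : ∀ α, WithOne (S α)) :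
    WithOne (SemigroupGraphProduct Γ S) :=
  (k.map fun α => incl Γ S α (d α)).prod

theorem vertexProd_cons (α : V) (k : List V) (d : ∀ α, WithOne (S α)) :
    vertexProd Γ (α :: k) d = incl Γ S α (d α) * vertexProd Γ k d := by
  simp [vertexProd]

/-- Factors at distinct vertices of a clique commute, so multiplication there is coordinatewise. -/
theorem vertexProd_mul {k : List V} (hk : k.Pairwise Γ.Adj) (d d' : ∀ α, WithOne (S α)) :
    vertexProd Γ k (d * d') = vertexProd Γ k d * vertexProd Γ k d' := by
  induction k with
  | nil => exact (mul_one _).symm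
  | cons α k ih =>
    obtain ⟨hα, hk⟩ := List.pairwise_cons.1 hk
    have hcomm : Commute (incl Γ S α (d' α)) (vertexProd Γ k d) := by
      refine Commute.list_prod_right _ _ fun x hx => ?_
      obtain ⟨β, hβ, rfl⟩ := List.mem_map.1 hx
      exact commute_incl (hα β hβ) _ _
    simp only [vertexProd_cons, ih hk, Pi.mul_apply, map_mul]
    rw [mul_assoc, mul_assoc, ← mul_assoc (incl Γ S α (d' α)), hcomm.eq, mul_assoc]

theorem vertexProd_eq_one {k : List V} {d : ∀ α, WithOne (S α)} (h : ∀ α ∈ k, d α = 1) :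
    vertexProd Γ k d = 1 := by
  refine List.prod_eq_one fun x hx => ?_
  obtain ⟨α, hα, rfl⟩ := List.mem_map.1 hx
  rw [h α hα, map_one]

theorem vertexProd_congr {k : List V} {d d' : ∀ α, WithOne (S α)} (h : ∀ α ∈ k, d α = d' α) :
    vertexProd Γ k d = vertexProd Γ k d' := by
  refine congrArg List.prod (List.map_congr_left fun α hα => ?_)
  rw [h α hα]

theorem vertexProd_projLetter {k : List V} (hk : k.Pairwise Γ.Adj) {p : Σ α, S α}
    (hp : p.1 ∈ k) : vertexProd Γ k (fun α => projLetter α p) = letterOne Γ p := by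
  induction k with
  | nil => simp at hp
  | cons α k ih =>
    obtain ⟨hα, hk⟩ := List.pairwise_cons.1 hk
    rw [vertexProd_cons]
    by_cases h : p.1 = α
    · subst h
      rw [vertexProd_eq_one fun β hβ => projLetter_of_ne (hα β hβ).ne, mul_one]
      exact congrArg (incl Γ S p.1) (projLetter_self p.1 p.2)
    · rw [projLetter_of_ne h, map_one, one_mul,
        ih hk ((List.mem_cons.1 hp).resolve_left h)]

theorem withOne_eq_one_of_mul_eq_one {T : Type*} [Semigroup T] {x y : WithOne T}
    (h : x * y = 1) : x = 1 ∧ y = 1 := by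
  induction x using WithOne.recOneCoe with
  | one => exact ⟨rfl, by simpa using h⟩
  | coe x =>
    induction y using WithOne.recOneCoe with
    | one => simp at h
    | coe y => exact absurd h (by rw [← WithOne.coe_mul]; exact WithOne.coe_ne_one)

/-- An element supported on a clique is the product of its projections. -/
theorem vertexProd_proj {k : List V} (hk : k.Pairwise Γ.Adj)
    (m : WithOne (SemigroupGraphProduct Γ S)) (hm : ∀ α ∉ k, proj Γ S α m = 1) :
    vertexProd Γ k (fun α => proj Γ S α m) = m := by
  induction m using induction_on_withOne with
  | h_one => exact vertexProd_eq_one fun α _ => map_one _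
  | h_mul p b ih =>
    -- The adjoined identity has no nontrivial factorisation, so both factors are again supported on
    -- `k`.
    have h : ∀ α ∉ k, projLetter α p = 1 ∧ proj Γ S α b = 1 := fun α hα =>
      withOne_eq_one_of_mul_eq_one (by rw [← proj_letterOne (Γ := Γ), ← map_mul, hm α hα])
    have hp : p.1 ∈ k := by
      by_contra hp
      have := (h p.1 hp).1
      rw [projLetter_self p.1 p.2] at this
      exact WithOne.coe_ne_one this
    conv_rhs => rw [← ih fun α hα => (h α hα).2, ← vertexProd_projLetter hk hp,
      ← vertexProd_mul hk]
    simp only [map_mul, proj_letterOne]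
    rfl

theorem proj_listProd_of_notMem {l : List (Σ α, S α)} {α : V} (h : ∀ p ∈ l, p.1 ≠ α) :
    proj Γ S α (listProd Γ l) = 1 := by
  rw [listProd, map_list_prod, List.map_map]
  refine List.prod_eq_one fun x hx => ?_
  obtain ⟨p, hp, rfl⟩ := List.mem_map.1 hx
  exact projLetter_of_ne (h p hp)

theorem proj_listProd_of_mem {l : List (Σ α, S α)} (hl : IsCliqueList Γ l) {p : Σ α, S α}
    (h : p ∈ l) : proj Γ S p.1 (listProd Γ l) = (p.2 : WithOne (S p.1)) := by
  induction l with
  | nil => simp at h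
  | cons q l ih =>
    obtain ⟨hq, hl⟩ := List.pairwise_cons.1 hl
    rw [listProd_cons, map_mul, proj_letterOne]
    rcases List.mem_cons.1 h with rfl | h
    · rw [proj_listProd_of_notMem fun r hr => (hq r hr).ne', mul_one]
      exact projLetter_self p.1 p.2
    · rw [projLetter_of_ne (hq p h).ne, one_mul, ih hl h]

/-- The left identities of a product of letters over a clique. -/
theorem mul_listProd_eq_self_iff {l : List (Σ α, S α)} (hl : IsCliqueList Γ l)
    (m : WithOne (SemigroupGraphProduct Γ S)) :
    m * listProd Γ l = listProd Γ l ↔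
      (∀ α, (∀ p ∈ l, p.1 ≠ α) → proj Γ S α m = 1) ∧
        ∀ p ∈ l, proj Γ S p.1 m * (p.2 : WithOne (S p.1)) = (p.2 : WithOne (S p.1)) := by
  constructor
  · intro h
    refine ⟨fun α hα => ?_, fun p hp => ?_⟩
    · simpa [proj_listProd_of_notMem hα] using congrArg (proj Γ S α) h
    · simpa [proj_listProd_of_mem hl hp] using congrArg (proj Γ S p.1) h
  · rintro ⟨h1, h2⟩
    have hk : (l.map Sigma.fst).Pairwise Γ.Adj := List.pairwise_map.2 hl
    have hmem : ∀ α ∉ l.map Sigma.fst, ∀ p ∈ l, p.1 ≠ α := by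
      rintro _ hα p hp rfl
      exact hα (List.mem_map_of_mem hp)
    -- Both factors are supported on the clique, so the equation can be checked one vertex at a
    -- time.
    rw [← vertexProd_proj hk m fun α hα => h1 α (hmem α hα),
      ← vertexProd_proj hk (listProd Γ l) fun α hα => proj_listProd_of_notMem (hmem α hα),
      ← vertexProd_mul hk]
    refine vertexProd_congr fun α hα => ?_
    obtain ⟨p, hp, rfl⟩ := List.mem_map.1 hα
    rw [Pi.mul_apply, proj_listProd_of_mem hl hp, h2 p hp]

end Projection

end SemigroupGraphProduct

/-! ### The two closure theorems -/

open SemigroupGraphProduct in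
theorem IsLeftAbundant.semigroupGraphProduct {V : Type u} (Γ : SimpleGraph V) {S : V → Type v}
    [∀ α, Semigroup (S α)] (h : ∀ α, IsLeftAbundant (S α)) :
    IsLeftAbundant (SemigroupGraphProduct Γ S) := by
  intro a
  choose f hf hR using h
  obtain ⟨l, hne, hl, ha⟩ := exists_isCliqueList a
  obtain ⟨e, he⟩ := exists_coe_eq_listProd (Γ := Γ) (l := mapLetters f l) (by simpa [mapLetters])
  have hidem := isIdempotentElem_listProd_mapLetters hf hl
  rw [← he] at hidem
  have hker := ha.trans (sameRightMulKer_listProd_mapLetters hR hl)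
  rw [← he] at hker
  exact ⟨e, WithOne.coe_injective hidem, hker⟩

open SemigroupGraphProduct in
theorem IsLeftFountain.semigroupGraphProduct {V : Type u} (Γ : SimpleGraph V) {S : V → Type v}
    [∀ α, Semigroup (S α)] (h : ∀ α, IsLeftFountain (S α)) :
    IsLeftFountain (SemigroupGraphProduct Γ S) := by
  intro a
  choose f hf hR using h
  obtain ⟨l, hne, hl, ha⟩ := exists_isCliqueList a
  obtain ⟨e, he⟩ := exists_coe_eq_listProd (Γ := Γ) (l := mapLetters f l) (by simpa [mapLetters])
  have hidem := isIdempotentElem_listProd_mapLetters hf hl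
  rw [← he] at hidem
  refine ⟨e, WithOne.coe_injective hidem, fun g hg => ?_⟩
  have key : ∀ p : Σ α, S α,
      proj Γ S p.1 g * (p.2 : WithOne (S p.1)) = (p.2 : WithOne (S p.1)) ↔
        proj Γ S p.1 g * (f p.1 p.2 : WithOne (S p.1)) = (f p.1 p.2 : WithOne (S p.1)) := by
    rintro ⟨α, x⟩
    have hi : IsIdempotentElem (proj Γ S α g) := by
      rw [IsIdempotentElem, ← map_mul, ← WithOne.coe_mul, hg.eq]
    dsimp only
    -- The projection of an idempotent is either the adjoined identity, which fixes everything, or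
    -- an idempotent of `S α`, to which `R~` applies.
    generalize proj Γ S α g = z at hi ⊢
    induction z using WithOne.recOneCoe with
    | one => simp only [one_mul]
    | coe z =>
      simp only [← WithOne.coe_mul, WithOne.coe_inj]
      exact hR α x z (WithOne.coe_injective hi)
  -- Taking `y = 1` in the kernel condition transfers left identities from `a` to the clique
  -- product.
  have h1 := ha g 1
  rw [one_mul, one_mul, mul_listProd_eq_self_iff hl] at h1
  have h2 := mul_listProd_eq_self_iff (hl.mapLetters f) (g : WithOne (SemigroupGraphProduct Γ S))
  rw [← he] at h2
  rw [← WithOne.coe_inj, WithOne.coe_mul, h1, ← WithOne.coe_inj, WithOne.coe_mul, h2]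
  simp only [mapLetters, List.forall_mem_map]
  exact and_congr_right' (forall₂_congr fun p _ => key p)

theorem corollary7p3 {V : Type u} (Γ : SimpleGraph V) (S : V → Type v)
    [∀ α, Semigroup (S α)] :
    ((∀ α, IsLeftAbundant (S α)) → IsLeftAbundant (SemigroupGraphProduct Γ S)) ∧
      ((∀ α, IsLeftFountain (S α)) → IsLeftFountain (SemigroupGraphProduct Γ S)) :=
  ⟨IsLeftAbundant.semigroupGraphProduct Γ, IsLeftFountain.semigroupGraphProduct Γ⟩
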